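/- Let $n\ge 0$ and $b\ge 1$ be integers. In the (monotone) $b$-biased Oriented-cycle game, two players, OMaker and OBreaker, take turns directing previously undirected edges of the complete graph $K_n$, OMaker moving first: on each turn OMaker directs exactly one undirected edge, and OBreaker directs at least one and at most $b$ undirected edges. The game ends when all edges are directed, and OMaker wins if and only if the resulting tournament contains a directed cycle. Let $t(n,\mathcal C)$ denote the threshold bias, that is, the non-negative integer such that, for every integer $b\ge 1$, OMaker has a winning strategy in the $b$-biased game if and only if $b\le t(n,\mathcal C)$. For a positive integer $b$ let $G_b(t):=-\frac t2+\sqrt{bt-\frac{t^2}{4}}$ for $t\in[0,4b]$ and $g_b(t):=G_b(t)-G_b(t-1)$ for $t\in[1,4b]$, and let $g_b^{-1}:[0,g_b(1)]\to\bigl[1,\,2b+\tfrac{1-\sqrt{8b^2-1}}{2}\bigr]$ be the inverse of the restriction of $g_b$ to the latter interval. For a positive integer $B$ define $$C_B:=1-\frac{1+\lfloor g_B(1)\rfloor}{2B}+\sum_{a=0}^{\lfloor g_B(1)\rfloor-1}\left(2-\sqrt{\frac{(2(a+\phi_{B,a})+1)^2}{(2(a+\phi_{B,a})+1)^2+1}}-\sqrt{\frac{(2a+3)^2}{(2a+3)^2+1}}\right),$$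 where $$\phi_{B,a}:=\frac12+\left(\frac{16B}{g_B^{-1}(a+\frac12)}-4\right)^{-1/2}\qquad(0\le a\le\lfloor g_B(1)\rfloor-1).$$ Theorem. For all integers $B\ge 3$ and $n\ge 0$, the threshold bias $t(n,\mathcal C)$ exists and $$t(n,\mathcal C)\le\frac{n}{C_B}+C_B B.$$ -/

import Mathlib

namespace OrientationGame

/-- A set of arcs on the vertex set `Fin n`; the arc `(v, w)` goes from `v` to `w`. -/
abbrev Arcs (n : ℕ) : Type := Finset (Fin n × Fin n)

/-- The available arcs of `D`: all `(v, w)` with `v ≠ w` such that neither `(v, w)` nor the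
reverse arc `(w, v)` is in `D`. -/
def available {n : ℕ} (D : Arcs n) : Arcs n :=
  Finset.univ.filter fun a => a.1 ≠ a.2 ∧ a ∉ D ∧ a.swap ∉ D

/-- `D` contains a directed cycle `v₀ → v₁ → ⋯ → vₖ → v₀` with distinct vertices
(the addition in `Fin (k + 1)` is cyclic). -/
def HasDirectedCycle {n : ℕ} (D : Arcs n) : Prop :=
  ∃ (k : ℕ) (v : Fin (k + 1) → Fin n), Function.Injective v ∧ ∀ i, (v i, v (i + 1)) ∈ D

/-- Under the monotone rules, a player with bias `k` may direct, in the position `D`, any number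
between `1` and `k` of undirected edges; `S` is the set of the new arcs. -/
def IsMove {n : ℕ} (k : ℕ) (D S : Arcs n) : Prop :=
  S ⊆ available D ∧ (∀ a ∈ S, a.swap ∉ S) ∧ 1 ≤ S.card ∧ S.card ≤ k

/-- The digraph formed by the moves of a history (a list of moves, the latest one first). -/
def position {n : ℕ} (h : List (Arcs n)) : Arcs n :=
  h.foldr (fun S D => D ∪ S) ∅

/-- The histories that can arise in the `b`-biased orientation game on `K_n` when OMaker follows
the strategy `σ`, a map from histories to moves, and OBreaker plays any legal moves. The players
alternate and OMaker begins, so OMaker is to move after histories of even length. OMaker has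
bias `1` and OBreaker has bias `b`. The game ends when no arc is available. -/
inductive Consistent {n : ℕ} (b : ℕ) (σ : List (Arcs n) → Arcs n) : List (Arcs n) → Prop
  | start : Consistent b σ []
  | maker {h : List (Arcs n)} : Consistent b σ h → Even h.length →
      IsMove 1 (position h) (σ h) → Consistent b σ (σ h :: h)
  | breaker {h : List (Arcs n)} {S : Arcs n} : Consistent b σ h → Odd h.length →
      IsMove b (position h) S → Consistent b σ (S :: h)

/-- OMaker has a winning strategy in the `b`-biased orientation game on `K_n` with the
property `P`: the strategy gives a legal move whenever OMaker is to move and some edge is still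
undirected, and every play in which it is followed ends in a tournament with the property `P`. -/
def OMakerWins {n : ℕ} (P : Arcs n → Prop) (b : ℕ) : Prop :=
  ∃ σ : List (Arcs n) → Arcs n, ∀ h : List (Arcs n), Consistent b σ h →
    (Even h.length → (available (position h)).Nonempty → IsMove 1 (position h) (σ h)) ∧
    (available (position h) = ∅ → P (position h))

/-- The threshold bias `t(n, P)`: the largest bias `b ≥ 1` for which OMaker wins, and `0` if OMaker
wins for no `b ≥ 1`. -/
noncomputable def thresholdBias {n : ℕ} (P : Arcs n → Prop) : ℕ :=
  sSup {b : ℕ | 1 ≤ b ∧ OMakerWins P b}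

/-- `G_b(t) = -t/2 + √(bt - t²/4)`, used for `0 ≤ t ≤ 4b`. -/
noncomputable def G (b : ℕ) (t : ℝ) : ℝ :=
  -t / 2 + √((b : ℝ) * t - t ^ 2 / 4)

/-- `g_b(t) = G_b(t) - G_b(t - 1)`, used for `1 ≤ t ≤ 4b`. -/
noncomputable def g (b : ℕ) (t : ℝ) : ℝ :=
  G b t - G b (t - 1)

/-- The inverse function `g_b⁻¹`, on `[0, g_b(1)]`, of the restriction of `g_b` to the interval
`[1, 2b + (1 - √(8b² - 1))/2]`. -/
noncomputable def gInv (b : ℕ) (x : ℝ) : ℝ :=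
  Function.invFunOn (g b) (Set.Icc 1 (2 * (b : ℝ) + (1 - √(8 * (b : ℝ) ^ 2 - 1)) / 2)) x

/-- `φ_{B,a} = 1/2 + (16B / g_B⁻¹(a + 1/2) - 4)^{-1/2}`. -/
noncomputable def phi (B a : ℕ) : ℝ :=
  1 / 2 + (16 * (B : ℝ) / gInv B ((a : ℝ) + 1 / 2) - 4) ^ (-(1 / 2) : ℝ)

/-- The constant `C_B`. -/
noncomputable def C (B : ℕ) : ℝ :=
  1 - (1 + (⌊g B 1⌋₊ : ℝ)) / (2 * (B : ℝ)) +
    ∑ a ∈ Finset.range ⌊g B 1⌋₊,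
      (2 - √((2 * ((a : ℝ) + phi B a) + 1) ^ 2 / ((2 * ((a : ℝ) + phi B a) + 1) ^ 2 + 1))
        - √((2 * (a : ℝ) + 3) ^ 2 / ((2 * (a : ℝ) + 3) ^ 2 + 1)))

end OrientationGame

/-!
OBreaker keeps the digraph an interval order. The intervals lie on a line with cuts, and `u → v` is
an arc if a cut separates the interval of `u` from that of `v`. One cut, the central one, carries
many intervals on both sides: all arcs from the `a` vertices below it to the `c` vertices above it
are present. Every other cut is a trace of one arc of OMaker and adjoins at most one interval on
either side. There are `s` such lower cuts and `s'` upper ones (`IsLayout`, `HasLayout`).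

An arc `(x, y)` of OMaker never joins the two sides of the central cut. If neither end is above it,
OBreaker may move vertices until `a' > a` vertices are below the central cut and `c' ≥ c` are above
it, with `x` among the former, and then insert a lower cut between `x` and `y`. Bringing `x` down and
`y` up to the new cut passes each of the `s` old lower cuts at most once, so all this directs at most
`s + a' c' - a c` further edges (`IsLayout.exists_answer`). The other case is the mirror image.

* If `a - s ≥ n - b` and `c - s' ≥ n - b`, OBreaker wins (`HasLayout.breakerWinsFrom_of_le`): he adds
  one vertex per round, on the side of OMaker's arc, which preserves both inequalities and costs at
  most `s + c ≤ a + c - (n - b) ≤ b` or `s' + a ≤ b`. When no vertex is left on the central cut, an arc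
  on one side costs less than the number of vertices there, which is at most `b`.
* To get there, OBreaker lets both excesses `a - s` and `c - s'` grow by `e` in each round as long as
  his bias admits this, with `e = 4`, `3`, `2`, `1` in turn, and at last lets one of them grow by `1`
  in each round. If `t` rounds have led to excesses `k`, the next round with increment `e` costs
  `(2 e + 1) k + (e + 1) t + e (e + 1)`, wherever OMaker has played. The excesses reach
  `0.2967 b - 11`, and thus OBreaker wins if `n ≤ 1.2967 b - 11` (`breakerWinsFrom_empty`).

The constant satisfies `C B ≤ 1 + ∑ (1 - m / √(m² + 1)) ≤ 1.2964`, where `m` runs over the integers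
from `2` on, because `φ ≥ 1 / 2` (`C_le`). For `B ≤ 6` it is at most `1`, so that the bound claimed is
at least `n`, and OBreaker wins whenever `b ≥ n` (`breakerWinsFrom_empty_of_le`). For `B ≥ 7`, if
`C B > 1`, a bias `b < n` above the bound claimed satisfies `n ≤ 1.2967 b - 11`
(`breakerWinsFrom_empty_of_lt`).
-/

namespace OrientationGame

/-! ### Winning positions of OBreaker -/

/-- OBreaker, with bias `b`, wins from the position `D` with OMaker to move: against every strategy
of OMaker that always moves legally, every play that has reached `D` extends to a play that ends
without a directed cycle. -/
def BreakerWinsFrom {n : ℕ} (b : ℕ) (D : Arcs n) : Prop :=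
  ∀ σ : List (Arcs n) → Arcs n,
    (∀ h, Consistent b σ h → Even h.length → (available (position h)).Nonempty →
      IsMove 1 (position h) (σ h)) →
    ∀ h, Consistent b σ h → Even h.length → position h = D →
      ∃ h', Consistent b σ h' ∧ available (position h') = ∅ ∧ ¬ HasDirectedCycle (position h')

theorem position_cons {n : ℕ} (S : Arcs n) (h : List (Arcs n)) :
    position (S :: h) = position h ∪ S := rfl

theorem BreakerWinsFrom.of_forall_arc {n b : ℕ} {D : Arcs n} (hD : ¬ HasDirectedCycle D)
    (H : ∀ e ∈ available D,
      (available (insert e D) = ∅ ∧ ¬ HasDirectedCycle (insert e D)) ∨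
      ∃ D', BreakerWinsFrom b D' ∧ insert e D ⊆ D' ∧ IsMove b (insert e D) (D' \ insert e D)) :
    BreakerWinsFrom b D := by
  intro σ hσ h hc hev hpos
  rcases Finset.eq_empty_or_nonempty (available D) with h0 | h0
  · exact ⟨h, hc, by rw [hpos, h0], by rwa [hpos]⟩
  have hm : IsMove 1 (position h) (σ h) := hσ h hc hev (by rwa [hpos])
  obtain ⟨hsub, -, h1, h2⟩ := id hm
  obtain ⟨e, he⟩ := Finset.card_eq_one.1 (le_antisymm h2 h1)
  have hc1 := Consistent.maker hc hev hm
  have hpos1 : position (σ h :: h) = insert e D := by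
    rw [position_cons, hpos, he, Finset.union_comm]; rfl
  have hea : e ∈ available D := by
    rw [← hpos]; exact hsub (by rw [he]; exact Finset.mem_singleton_self e)
  rcases H e hea with ⟨ha, hcy⟩ | ⟨D', hw, hs, hmv⟩
  · exact ⟨_, hc1, by rw [hpos1, ha], by rwa [hpos1]⟩
  · have hodd : Odd (σ h :: h).length := by
      rw [List.length_cons]; exact hev.add_one
    rw [← hpos1] at hmv
    have hc2 := Consistent.breaker hc1 hodd hmv
    refine hw σ hσ _ hc2 ?_ ?_
    · rw [List.length_cons]; exact hodd.add_one
    · rw [position_cons, hpos1]; exact Finset.union_sdiff_of_subset hs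

theorem BreakerWinsFrom.not_oMakerWins {n b : ℕ} (h : BreakerWinsFrom b (∅ : Arcs n)) :
    ¬ OMakerWins (HasDirectedCycle (n := n)) b := by
  rintro ⟨σ, hσ⟩
  obtain ⟨h', hc, ha, hcy⟩ := h σ (fun h hc => (hσ h hc).1) [] Consistent.start (by simp) rfl
  exact hcy ((hσ h' hc).2 ha)

theorem Consistent.mono {n b b' : ℕ} (hb : b ≤ b') {σ : List (Arcs n) → Arcs n}
    {h : List (Arcs n)} (hc : Consistent b σ h) : Consistent b' σ h := by
  induction hc with
  | start => exact .start
  | maker _ he hm ih => exact .maker ih he hm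
  | breaker _ ho hm ih => exact .breaker ih ho ⟨hm.1, hm.2.1, hm.2.2.1, hm.2.2.2.trans hb⟩

theorem OMakerWins.anti {n b b' : ℕ} {P : Arcs n → Prop} (hb : b ≤ b') (h : OMakerWins P b') :
    OMakerWins P b := by
  obtain ⟨σ, hσ⟩ := h
  exact ⟨σ, fun h hc => hσ h (hc.mono hb)⟩

theorem isMove_sdiff {n k : ℕ} {D D' : Arcs n} (hirr : ∀ v, (v, v) ∉ D')
    (hasymm : ∀ a ∈ D', a.swap ∉ D') (hsub : D ⊆ D') (h1 : (D' \ D).Nonempty)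
    (hk : (D' \ D).card ≤ k) : IsMove k D (D' \ D) := by
  refine ⟨fun a ha => ?_, fun a ha hs => ?_, h1.card_pos, hk⟩
  · rw [Finset.mem_sdiff] at ha
    simp only [available, Finset.mem_filter, Finset.mem_univ, true_and]
    refine ⟨fun h => ?_, ha.2, fun h => hasymm a ha.1 (hsub h)⟩
    obtain ⟨u, v⟩ := a
    obtain rfl : u = v := h
    exact hirr _ ha.1
  · exact hasymm a (Finset.mem_sdiff.1 ha).1 (Finset.mem_sdiff.1 hs).1

/-! ### Layouts -/

/-- `l` and `r` attach to every vertex `v` an interval between cuts of a line, which carries `s` lower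
cuts `1, …, s`, the central cut `s + 1` and `s'` upper cuts: `l v` is the last cut before the
interval and `r v + 1` the first cut after it. A cut other than the central one is the last cut
before at most one interval and the first cut after at most one interval. (The values `l v = 0` and
`r v = s + 1 + s'` say that there is no such cut.) -/
structure IsLayout {n : ℕ} (s s' : ℕ) (l r : Fin n → ℕ) : Prop where
  le : ∀ v, l v ≤ r v
  bound : ∀ v, r v ≤ s + 1 + s'
  injL : ∀ u v, l u = l v → l u ≠ 0 → l u ≠ s + 1 → u = v
  injR : ∀ u v, r u = r v → r u ≠ s → r u ≠ s + 1 + s' → u = v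

/-- The arcs of the interval order: `u → v` if some cut separates the interval of `u` from that of
`v`. -/
def layoutArcs {n : ℕ} (l r : Fin n → ℕ) : Arcs n :=
  Finset.univ.filter fun e => r e.1 < l e.2

/-- The vertices below the central cut. -/
def lower {n : ℕ} (s : ℕ) (r : Fin n → ℕ) : Finset (Fin n) :=
  Finset.univ.filter fun v => r v ≤ s

/-- The vertices above the central cut. -/
def upper {n : ℕ} (s : ℕ) (l : Fin n → ℕ) : Finset (Fin n) :=
  Finset.univ.filter fun v => s + 1 ≤ l v

/-- `D` is the interval order of a layout with `s` lower cuts, `s'` upper cuts, `a` vertices below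
the central cut and `c` vertices above it. -/
def HasLayout {n : ℕ} (D : Arcs n) (s s' a c : ℕ) : Prop :=
  ∃ l r : Fin n → ℕ, IsLayout s s' l r ∧ D = layoutArcs l r ∧
    (lower s r).card = a ∧ (upper s l).card = c

section

variable {n : ℕ} {s s' : ℕ} {l r : Fin n → ℕ}

@[simp] theorem mem_layoutArcs {e : Fin n × Fin n} : e ∈ layoutArcs l r ↔ r e.1 < l e.2 := by
  simp [layoutArcs]

@[simp] theorem mem_lower {v : Fin n} : v ∈ lower s r ↔ r v ≤ s := by simp [lower]

@[simp] theorem mem_upper {v : Fin n} : v ∈ upper s l ↔ s + 1 ≤ l v := by simp [upper]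

theorem not_hasDirectedCycle_layoutArcs (h : ∀ v, l v ≤ r v) :
    ¬ HasDirectedCycle (layoutArcs l r) := by
  rintro ⟨k, v, -, hv⟩
  obtain ⟨i, -, hi⟩ := Finset.exists_max_image Finset.univ (fun i => l (v i)) ⟨0, by simp⟩
  have h1 := mem_layoutArcs.1 (hv i)
  have h2 := hi (i + 1) (Finset.mem_univ _)
  have h3 := h (v i)
  simp only at h1 h2
  omega

theorem isMove_layoutArcs (h : ∀ v, l v ≤ r v) {k : ℕ} {D : Arcs n} (hsub : D ⊆ layoutArcs l r)
    (h1 : (layoutArcs l r \ D).Nonempty) (hk : (layoutArcs l r \ D).card ≤ k) :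
    IsMove k D (layoutArcs l r \ D) := by
  refine isMove_sdiff (fun v hv => ?_) (fun e he hes => ?_) hsub h1 hk
  · have := h v
    simp only [mem_layoutArcs] at hv
    omega
  · have h1 := h e.1
    have h2 := h e.2
    simp only [mem_layoutArcs, Prod.fst_swap, Prod.snd_swap] at he hes
    omega

/-- `l` after a new cut has been inserted just above the cut `p`, and `y` moved above it. -/
def insertL (l : Fin n → ℕ) (p : ℕ) (y v : Fin n) : ℕ :=
  if v = y then p + 1 else if p < l v then l v + 1 else l v

/-- `r` after a new cut has been inserted just above the cut `p`, and `x` moved below it. -/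
def insertR (r : Fin n → ℕ) (p : ℕ) (x u : Fin n) : ℕ :=
  if u = x then p else if p ≤ r u then r u + 1 else r u

theorem IsLayout.insert_cut (h : IsLayout s s' l r) {x y : Fin n} {p : ℕ} (hxy : x ≠ y)
    (hx : r x ≤ s) (hlx : l x ≤ p) (hly : l y ≤ p) (hrx : p ≤ r x) (hry : p ≤ r y) :
    IsLayout (s + 1) s' (insertL l p y) (insertR r p x) where
  le v := by
    have := h.le v
    unfold insertL insertR
    split_ifs <;> subst_vars <;> omega
  bound v := by
    have := h.bound v
    unfold insertR
    split_ifs <;> omega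
  injL u v := by
    have := h.injL u v
    unfold insertL
    split_ifs <;> intro h1 h2 h3 <;> omega
  injR u v := by
    have := h.injR u v
    have h4 := h.bound u
    unfold insertR
    split_ifs <;> intro h1 h2 h3 <;> omega

theorem lower_insertR {x : Fin n} {p : ℕ} (hx : r x ≤ s) (hrx : p ≤ r x) :
    lower (s + 1) (insertR r p x) = lower s r := by
  ext v
  simp only [mem_lower, insertR]
  split_ifs <;> subst_vars <;> omega

theorem upper_insertL {y : Fin n} {p : ℕ} (hp : p ≤ s) (hly : l y ≤ p) :
    upper (s + 1) (insertL l p y) = upper s l := by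
  ext v
  simp only [mem_upper, insertL]
  split_ifs <;> subst_vars <;> omega

theorem layoutArcs_subset_insert_cut {x y : Fin n} {p : ℕ} (hly : l y ≤ p) (hrx : p ≤ r x) :
    insert (x, y) (layoutArcs l r) ⊆ layoutArcs (insertL l p y) (insertR r p x) := by
  rintro ⟨u, v⟩ h
  simp only [Finset.mem_insert, mem_layoutArcs, Prod.mk.injEq, insertL, insertR] at h ⊢
  split_ifs <;> subst_vars <;> simp_all <;> omega

/-- The vertices that lie above some lower cut beyond `p` but not above the central cut: a tail `x`
that is brought down to the cut `p` comes to precede at most these and those it preceded before. -/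
def passedByTail (l : Fin n → ℕ) (s p : ℕ) : Finset (Fin n) :=
  Finset.univ.filter fun v => p < l v ∧ l v ≤ s

/-- The vertices that lie below the cut `p`: a head `y` that is brought up beyond `p` comes to be
preceded by at most these and those that preceded it before. -/
def passedByHead (r : Fin n → ℕ) (p : ℕ) : Finset (Fin n) :=
  Finset.univ.filter fun u => r u < p

theorem layoutArcs_insert_cut_sdiff_subset {x y : Fin n} {p : ℕ} (hx : r x ≤ s) :
    layoutArcs (insertL l p y) (insertR r p x) \ layoutArcs l r ⊆
      insert (x, y) ((passedByTail l s p).image (fun v => (x, v)) ∪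
        (passedByHead r p).image (fun u => (u, y))) := by
  rintro ⟨u, v⟩ h
  simp only [Finset.mem_sdiff, mem_layoutArcs, Finset.mem_insert, Finset.mem_union,
    Finset.mem_image, passedByTail, passedByHead, Finset.mem_filter, Finset.mem_univ, true_and,
    Prod.mk.injEq, insertL, insertR] at h ⊢
  obtain ⟨h1, h2⟩ := h
  by_cases hu : u = x
  · by_cases hv : v = y
    · exact Or.inl ⟨hu, hv⟩
    · subst hu
      refine Or.inr (Or.inl ⟨v, ?_, rfl, rfl⟩)
      simp only [if_true, hv, if_false] at h1
      split_ifs at h1 <;> omega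
  · by_cases hv : v = y
    · subst hv
      refine Or.inr (Or.inr ⟨u, ?_, rfl, rfl⟩)
      simp only [if_true, hu, if_false] at h1
      split_ifs at h1 <;> omega
    · exfalso
      simp only [hu, hv, if_false] at h1
      split_ifs at h1 <;> omega

theorem card_sdiff_insert_cut_le {x y : Fin n} {p : ℕ} (hx : r x ≤ s) :
    (layoutArcs (insertL l p y) (insertR r p x) \ layoutArcs l r).card ≤
      (passedByTail l s p).card + (passedByHead r p).card + 1 := by
  refine (Finset.card_le_card (layoutArcs_insert_cut_sdiff_subset hx)).trans
    ((Finset.card_insert_le _ _).trans ?_)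
  gcongr
  exact (Finset.card_union_le _ _).trans (add_le_add Finset.card_image_le Finset.card_image_le)

/-- Each lower cut is passed at most once, by the tail if it is beyond `p` and by the head
otherwise. -/
theorem IsLayout.card_passed_le (h : IsLayout s s' l r) {p : ℕ} (hp : p ≤ s) :
    (passedByTail l s p).card + (passedByHead r p).card ≤ s := by
  have h1 : (passedByTail l s p).card ≤ (Finset.Ioc p s).card := by
    refine Finset.card_le_card_of_injOn l (fun v hv => ?_) (fun u hu v hv huv => ?_)
    · simpa [passedByTail] using hv
    · simp only [passedByTail, Finset.coe_filter, Finset.mem_univ, true_and,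
        Set.mem_ofPred_eq] at hu hv
      exact h.injL u v huv (by omega) (by omega)
  have h2 : (passedByHead r p).card ≤ (Finset.range p).card := by
    refine Finset.card_le_card_of_injOn r (fun v hv => ?_) (fun u hu v hv huv => ?_)
    · simpa [passedByHead] using hv
    · simp only [passedByHead, Finset.coe_filter, Finset.mem_univ, true_and,
        Set.mem_ofPred_eq] at hu hv
      exact h.injR u v huv (by omega) (by omega)
  rw [Nat.card_Ioc] at h1
  rw [Finset.card_range] at h2
  omega

/-- Once every vertex is below or above the central cut, the vertices passed by the new arc are
distinct vertices below the central cut, other than its two ends. -/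
theorem IsLayout.card_passed_add_two_le (h : IsLayout s s' l r) {x y : Fin n} {p : ℕ}
    (hcov : ∀ v, r v ≤ s ∨ s + 1 ≤ l v) (hxy : x ≠ y) (hp : p ≤ s) (hlx : l x ≤ p) (hly : l y ≤ p)
    (hrx : p ≤ r x) (hry : p ≤ r y) :
    (passedByTail l s p).card + (passedByHead r p).card + 2 ≤ (lower s r).card := by
  have hd : Disjoint (passedByTail l s p) (passedByHead r p) := by
    rw [Finset.disjoint_left]
    intro v hv hv'
    have := h.le v
    simp only [passedByTail, passedByHead, Finset.mem_filter] at hv hv'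
    omega
  have hd2 : Disjoint (passedByTail l s p ∪ passedByHead r p) {x, y} := by
    rw [Finset.disjoint_right]
    intro v hv hv'
    simp only [passedByTail, passedByHead, Finset.mem_filter, Finset.mem_union, Finset.mem_insert,
      Finset.mem_singleton, Finset.mem_univ, true_and] at hv hv'
    rcases hv with rfl | rfl <;> omega
  rw [← Finset.card_union_of_disjoint hd, ← Finset.card_pair hxy,
    ← Finset.card_union_of_disjoint hd2]
  refine Finset.card_le_card fun v hv => ?_
  simp only [passedByTail, passedByHead, Finset.mem_filter, Finset.mem_union, Finset.mem_insert,
    Finset.mem_singleton, Finset.mem_univ, true_and, mem_lower] at hv ⊢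
  rcases hv with (hv | hv) | rfl | rfl
  · have := hcov v; omega
  · omega
  · have := hcov v; omega
  · have := hcov v; omega

/-- `l` after the vertices of `Q` have been moved above the central cut. -/
def raise (l : Fin n → ℕ) (s : ℕ) (Q : Finset (Fin n)) (v : Fin n) : ℕ :=
  if v ∈ Q then s + 1 else l v

/-- `r` after the vertices of `P` have been moved below the central cut. -/
def depress (r : Fin n → ℕ) (s : ℕ) (P : Finset (Fin n)) (v : Fin n) : ℕ :=
  if v ∈ P then s else r v

/-- The vertices that the central cut passes through. -/
def middle (l r : Fin n → ℕ) (s : ℕ) : Finset (Fin n) :=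
  Finset.univ.filter fun v => l v ≤ s ∧ s + 1 ≤ r v

@[simp] theorem mem_middle {v : Fin n} : v ∈ middle l r s ↔ l v ≤ s ∧ s + 1 ≤ r v := by
  simp [middle]

variable {P Q : Finset (Fin n)}

theorem IsLayout.move (h : IsLayout s s' l r) (hP : P ⊆ middle l r s) (hQ : Q ⊆ middle l r s)
    (hd : Disjoint P Q) : IsLayout s s' (raise l s Q) (depress r s P) where
  le v := by
    have h1 := h.le v
    have h2 := @hP v
    have h3 := @hQ v
    have h4 := @Finset.disjoint_left _ P Q
    simp only [mem_middle] at h2 h3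
    unfold raise depress
    split_ifs with h5 h6 h6
    · exact absurd h5 (h4.1 hd h6)
    · have := h3 h5; omega
    · exact (h2 h6).1
    · exact h1
  bound v := by
    have := h.bound v
    unfold depress
    split_ifs <;> omega
  injL u v := by
    have := h.injL u v
    unfold raise
    split_ifs <;> intro h1 h2 h3 <;> omega
  injR u v := by
    have := h.injR u v
    unfold depress
    split_ifs <;> intro h1 h2 h3 <;> omega

theorem lower_depress : lower s (depress r s P) = lower s r ∪ P := by
  ext v
  simp only [mem_lower, depress, Finset.mem_union]
  split_ifs with h <;> simp [h]

theorem upper_raise : upper s (raise l s Q) = upper s l ∪ Q := by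
  ext v
  simp only [mem_upper, raise, Finset.mem_union]
  split_ifs with h <;> simp [h]

theorem layoutArcs_subset_move (hP : P ⊆ middle l r s) (hQ : Q ⊆ middle l r s) :
    layoutArcs l r ⊆ layoutArcs (raise l s Q) (depress r s P) := by
  rintro ⟨u, v⟩ h
  have h2 := @hP u
  have h3 := @hQ v
  simp only [mem_layoutArcs, raise, depress, mem_middle] at h h2 h3 ⊢
  split_ifs with h5 h6 h6
  · omega
  · have := h2 h5; omega
  · have := h3 h6; omega
  · exact h

theorem lower_product_upper_subset : lower s r ×ˢ upper s l ⊆ layoutArcs l r := by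
  rintro ⟨u, v⟩ h
  simp only [Finset.mem_product, mem_lower, mem_upper, mem_layoutArcs] at h ⊢
  omega

theorem layoutArcs_move_sdiff_subset :
    layoutArcs (raise l s Q) (depress r s P) \ layoutArcs l r ⊆
      (lower s r ∪ P) ×ˢ (upper s l ∪ Q) \ lower s r ×ˢ upper s l := by
  rintro ⟨u, v⟩ h
  have hsub := @lower_product_upper_subset n s l r (u, v)
  rw [Finset.mem_sdiff] at h ⊢
  refine ⟨?_, fun hm => h.2 (hsub hm)⟩
  simp only [mem_layoutArcs, raise, depress, Finset.mem_product, Finset.mem_union, mem_lower,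
    mem_upper] at h ⊢
  split_ifs at h with h5 h6 h6
  · exact ⟨.inr h5, .inr h6⟩
  · exact ⟨.inr h5, .inl (by omega)⟩
  · exact ⟨.inl (by omega), .inr h6⟩
  · omega

theorem card_middle_add (h : IsLayout s s' l r) :
    (middle l r s).card + ((lower s r).card + (upper s l).card) = n := by
  have h1 : Disjoint (lower s r) (upper s l) := by
    rw [Finset.disjoint_left]
    intro v hv hv'
    have := h.le v
    simp only [mem_lower, mem_upper] at hv hv'
    omega
  have h2 : Disjoint (middle l r s) (lower s r ∪ upper s l) := by
    rw [Finset.disjoint_left]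
    intro v hv hv'
    simp only [mem_lower, mem_upper, mem_middle, Finset.mem_union] at hv hv'
    omega
  rw [← Finset.card_union_of_disjoint h1, ← Finset.card_union_of_disjoint h2]
  have : middle l r s ∪ (lower s r ∪ upper s l) = Finset.univ := by
    ext v
    simp only [mem_lower, mem_upper, mem_middle, Finset.mem_union, Finset.mem_univ, iff_true]
    omega
  rw [this, Finset.card_univ, Fintype.card_fin]

end

/-! ### Reversal of all arcs -/

/-- The digraph with all arcs reversed. -/
def reverseArcs {n : ℕ} (D : Arcs n) : Arcs n :=
  D.map (Equiv.prodComm (Fin n) (Fin n)).toEmbedding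

section

variable {n : ℕ}

@[simp] theorem mem_reverseArcs {D : Arcs n} {e : Fin n × Fin n} :
    e ∈ reverseArcs D ↔ e.swap ∈ D := by
  simp [reverseArcs, Finset.mem_map_equiv]

@[simp] theorem reverseArcs_reverseArcs (D : Arcs n) : reverseArcs (reverseArcs D) = D := by
  ext; simp

@[simp] theorem card_reverseArcs (D : Arcs n) : (reverseArcs D).card = D.card :=
  Finset.card_map _

theorem reverseArcs_sdiff (D D' : Arcs n) :
    reverseArcs (D \ D') = reverseArcs D \ reverseArcs D' := by
  ext; simp

theorem reverseArcs_insert (e : Fin n × Fin n) (D : Arcs n) :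
    reverseArcs (insert e D) = insert e.swap (reverseArcs D) := by
  ext a
  simp only [mem_reverseArcs, Finset.mem_insert]
  rw [← Prod.swap_inj, Prod.swap_swap]

theorem reverseArcs_subset_iff {D D' : Arcs n} : reverseArcs D ⊆ D' ↔ D ⊆ reverseArcs D' := by
  constructor
  · intro h e he
    exact mem_reverseArcs.2 (h (by simpa using he))
  · intro h e he
    simpa using h (mem_reverseArcs.1 he)

section

variable {s s' : ℕ} {l r : Fin n → ℕ}

theorem IsLayout.reverse (h : IsLayout s s' l r) :
    IsLayout s' s (fun v => s + 1 + s' - r v) (fun v => s + 1 + s' - l v) where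
  le v := Nat.sub_le_sub_left (h.le v) _
  bound v := by omega
  injL u v := by
    have := h.injR u v
    have := h.bound u
    have := h.bound v
    omega
  injR u v := by
    have := h.injL u v
    have := h.le u
    have := h.le v
    have := h.bound u
    have := h.bound v
    omega

theorem IsLayout.layoutArcs_reverse (h : IsLayout s s' l r) :
    layoutArcs (fun v => s + 1 + s' - r v) (fun v => s + 1 + s' - l v) =
      reverseArcs (layoutArcs l r) := by
  ext ⟨u, v⟩
  have := h.le u
  have := h.le v
  have := h.bound u
  have := h.bound v
  simp only [mem_reverseArcs, mem_layoutArcs, Prod.swap_prod_mk]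
  omega

theorem IsLayout.lower_reverse (h : IsLayout s s' l r) :
    lower s' (fun v => s + 1 + s' - l v) = upper s l := by
  ext v
  have := h.le v
  have := h.bound v
  simp only [mem_lower, mem_upper]
  omega

theorem IsLayout.upper_reverse (h : IsLayout s s' l r) :
    upper s' (fun v => s + 1 + s' - r v) = lower s r := by
  ext v
  have := h.bound v
  simp only [mem_lower, mem_upper]
  omega

end

theorem HasLayout.reverse {D : Arcs n} {s s' a c : ℕ} (h : HasLayout D s s' a c) :
    HasLayout (reverseArcs D) s' s c a := by
  obtain ⟨l, r, h, rfl, rfl, rfl⟩ := h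
  exact ⟨_, _, h.reverse, h.layoutArcs_reverse.symm, by rw [h.lower_reverse],
    by rw [h.upper_reverse]⟩

/-! ### The answer of OBreaker to one arc -/

theorem HasLayout.not_hasDirectedCycle {D : Arcs n} {s s' a c : ℕ} (h : HasLayout D s s' a c) :
    ¬ HasDirectedCycle D := by
  obtain ⟨l, r, h, rfl, -, -⟩ := h
  exact not_hasDirectedCycle_layoutArcs h.le

theorem HasLayout.isMove {D D' : Arcs n} {s s' a c k : ℕ} (h : HasLayout D' s s' a c)
    (hsub : D ⊆ D') (h1 : (D' \ D).Nonempty) (hk : (D' \ D).card ≤ k) : IsMove k D (D' \ D) := by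
  obtain ⟨l, r, h, rfl, -, -⟩ := h
  exact isMove_layoutArcs h.le hsub h1 hk

theorem HasLayout.add_le {D : Arcs n} {s s' a c : ℕ} (h : HasLayout D s s' a c) : a + c ≤ n := by
  obtain ⟨l, r, h, rfl, rfl, rfl⟩ := h
  have := card_middle_add h
  omega

/-- Sets of vertices to be moved below and above the central cut, if `x` has to come below it and
`y` must not come above it. -/
theorem IsLayout.exists_move_sets {s s' : ℕ} {l r : Fin n → ℕ} (h : IsLayout s s' l r)
    {x : Fin n} (y : Fin n) (hlx : l x ≤ s) {a' c' : ℕ} (ha : (lower s r).card + 1 ≤ a')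
    (hc : (upper s l).card ≤ c') (hn : a' + c' ≤ n)
    (hn' : c' = (upper s l).card ∨ a' + c' < n) :
    ∃ P Q : Finset (Fin n), P ⊆ middle l r s ∧ Q ⊆ middle l r s ∧ Disjoint P Q ∧
      (lower s r ∪ P).card = a' ∧ (upper s l ∪ Q).card = c' ∧ x ∈ lower s r ∪ P ∧ y ∉ Q ∧
      P.Nonempty ∧ (Q.Nonempty ↔ (upper s l).card < c') := by
  have hm := card_middle_add h
  have hX : ({x} ∩ middle l r s) ⊆ middle l r s := Finset.inter_subset_right
  have hXc : ({x} ∩ middle l r s).card ≤ 1 :=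
    (Finset.card_le_card Finset.inter_subset_left).trans (by simp)
  obtain ⟨P, hXP, hP, hPc⟩ := Finset.exists_subsuperset_card_eq (n := a' - (lower s r).card) hX
    (by omega) (by omega)
  have hrest : c' - (upper s l).card ≤ ((middle l r s \ P).erase y).card := by
    rcases hn' with rfl | hn'
    · simp
    · have h1 := Finset.pred_card_le_card_erase (s := middle l r s \ P) (a := y)
      have h2 := Finset.card_sdiff_of_subset hP
      omega
  obtain ⟨Q, hQ, hQc⟩ := Finset.exists_subset_card_eq hrest
  have hQm : Q ⊆ middle l r s := fun v hv =>
    (Finset.mem_sdiff.1 (Finset.mem_of_mem_erase (hQ hv))).1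
  have hPl : Disjoint (lower s r) P := by
    rw [Finset.disjoint_left]
    intro v hv hv'
    have := hP hv'
    simp only [mem_lower, mem_middle] at this hv
    omega
  have hQu : Disjoint (upper s l) Q := by
    rw [Finset.disjoint_left]
    intro v hv hv'
    have := hQm hv'
    simp only [mem_upper, mem_middle] at this hv
    omega
  refine ⟨P, Q, hP, hQm, ?_, ?_, ?_, ?_, ?_, ?_, ?_⟩
  · rw [Finset.disjoint_right]
    exact fun v hv => (Finset.mem_sdiff.1 (Finset.mem_of_mem_erase (hQ hv))).2
  · rw [Finset.card_union_of_disjoint hPl]; omega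
  · rw [Finset.card_union_of_disjoint hQu]; omega
  · rw [Finset.mem_union, mem_lower]
    by_cases hx : r x ≤ s
    · exact Or.inl hx
    · refine Or.inr (hXP ?_)
      simp only [Finset.mem_inter, Finset.mem_singleton, mem_middle, true_and]
      omega
  · exact fun hy => (Finset.mem_erase.1 (hQ hy)).1 rfl
  · rw [← Finset.card_pos]; omega
  · rw [← Finset.card_pos]; omega

/-- The answer to an arc `(x, y)` both of whose ends are not above the central cut: vertices are
moved below and above the central cut until there are `a'` and `c'` of them, and then a lower cut is
inserted between `x` and `y`. The condition `hne` ensures that this directs at least one further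
edge. -/
theorem IsLayout.exists_answer {s s' : ℕ} {l r : Fin n → ℕ} (h : IsLayout s s' l r)
    {x y : Fin n} (hxy : x ≠ y) (hyx : l y ≤ r x) (hxy' : l x ≤ r y) (hlx : l x ≤ s) (hly : l y ≤ s)
    {a' c' : ℕ} (ha : (lower s r).card + 1 ≤ a') (hc : (upper s l).card ≤ c') (hn : a' + c' ≤ n)
    (hn' : c' = (upper s l).card ∨ a' + c' < n)
    (hne : (upper s l).card < c' ∨ s' < (upper s l).card) :
    ∃ D', HasLayout D' (s + 1) s' a' c' ∧ insert (x, y) (layoutArcs l r) ⊆ D' ∧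
      (D' \ insert (x, y) (layoutArcs l r)).Nonempty ∧
      (D' \ insert (x, y) (layoutArcs l r)).card + (lower s r).card * (upper s l).card ≤
        s + a' * c' := by
  obtain ⟨P, Q, hP, hQ, hPQ, hPc, hQc, hxP, hyQ, hPne, hQne⟩ :=
    h.exists_move_sets y hlx ha hc hn hn'
  have hm := h.move hP hQ hPQ
  set l₁ := raise l s Q with hl₁
  set r₁ := depress r s P with hr₁
  have hxQ : x ∉ Q := by
    intro hx
    have h1 := hQ hx
    rcases Finset.mem_union.1 hxP with h2 | h2
    · simp only [mem_lower, mem_middle] at h1 h2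
      omega
    · exact Finset.disjoint_left.1 hPQ h2 hx
  have hlx₁ : l₁ x = l x := by simp [hl₁, raise, hxQ]
  have hly₁ : l₁ y = l y := by simp [hl₁, raise, hyQ]
  have hrx₁ : r₁ x ≤ s := by rw [← mem_lower, hr₁, lower_depress]; exact hxP
  have hrx₂ : r₁ x = s ∨ r₁ x = r x := by
    simp only [hr₁, depress]; split_ifs <;> simp
  have hry₂ : r₁ y = s ∨ r₁ y = r y := by
    simp only [hr₁, depress]; split_ifs <;> simp
  have hlrx := h.le x
  have hlry := h.le y
  obtain ⟨p, hlp, hlp', hpx, hpy⟩ : ∃ p, l₁ x ≤ p ∧ l₁ y ≤ p ∧ p ≤ r₁ x ∧ p ≤ r₁ y :=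
    ⟨max (l x) (l y), by omega, by omega, by omega, by omega⟩
  have hps : p ≤ s := hpx.trans hrx₁
  have hsub₁ : layoutArcs l r ⊆ layoutArcs l₁ r₁ := layoutArcs_subset_move hP hQ
  have hsub₂ : insert (x, y) (layoutArcs l₁ r₁) ⊆
      layoutArcs (insertL l₁ p y) (insertR r₁ p x) := layoutArcs_subset_insert_cut hlp' hpx
  have hxyD : (x, y) ∉ layoutArcs l r := by
    simp only [mem_layoutArcs]; omega
  have hlow : lower s r₁ = lower s r ∪ P := lower_depress
  have hupp : upper s l₁ = upper s l ∪ Q := upper_raise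
  refine ⟨layoutArcs (insertL l₁ p y) (insertR r₁ p x), ⟨_, _,
    hm.insert_cut hxy hrx₁ hlp hlp' hpx hpy, rfl, ?_, ?_⟩,
    (Finset.insert_subset_insert _ hsub₁).trans hsub₂, ?_, ?_⟩
  · rw [lower_insertR hrx₁ hpx, hlow, hPc]
  · rw [upper_insertL hps hlp', hupp, hQc]
  · obtain ⟨z, hz⟩ := hPne
    have hzm := hP hz
    rw [mem_middle] at hzm
    -- A vertex above the central cut after the answer that `z` does not precede before it.
    obtain ⟨w, hw, hw'⟩ : ∃ w, w ∈ upper s l ∪ Q ∧ l w ≤ r z := by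
      rcases Finset.eq_empty_or_nonempty Q with hQ0 | ⟨w, hw⟩
      · have hs' : s' < (upper s l).card := by
          rcases hne with h1 | h1
          · have := hQne.2 h1
            simp [hQ0] at this
          · exact h1
        by_contra! hcon
        have h1 : (upper s l).card ≤ (Finset.Ioc (s + 1) (s + 1 + s')).card := by
          refine Finset.card_le_card_of_injOn l (fun v hv => ?_) (fun u hu v hv huv => ?_)
          · have h3 := hcon v (Finset.mem_union_left _ hv)
            have h4 := h.le v
            have h5 := h.bound v
            simp only [Finset.coe_Ioc, Set.mem_Ioc]
            omega
          · have h3 := hcon u (Finset.mem_union_left _ hu)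
            exact h.injL u v huv (by omega) (by omega)
        rw [Nat.card_Ioc] at h1
        omega
      · have := hQ hw
        rw [mem_middle] at this
        exact ⟨w, Finset.mem_union_right _ hw, by omega⟩
    refine ⟨(z, w), Finset.mem_sdiff.2 ⟨hsub₂ (Finset.mem_insert_of_mem
      (lower_product_upper_subset (s := s) ?_)), ?_⟩⟩
    · rw [Finset.mem_product, hlow, hupp]
      exact ⟨Finset.mem_union_right _ hz, hw⟩
    · rw [Finset.mem_insert, mem_layoutArcs, Prod.mk.injEq]
      rintro (⟨-, rfl⟩ | h1)
      · rcases Finset.mem_union.1 hw with h2 | h2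
        · rw [mem_upper] at h2; omega
        · exact hyQ h2
      · simp only at h1; omega
  · set D := layoutArcs l r
    set D₁ := layoutArcs l₁ r₁
    set D₂ := layoutArcs (insertL l₁ p y) (insertR r₁ p x)
    have hxyD₂ : (x, y) ∈ D₂ := hsub₂ (Finset.mem_insert_self _ _)
    have h1 : (D₂ \ insert (x, y) D).card + 1 = (D₂ \ D).card := by
      rw [Finset.sdiff_insert]
      exact Finset.card_erase_add_one (Finset.mem_sdiff.2 ⟨hxyD₂, hxyD⟩)
    have h2 : (D₂ \ D).card ≤ (D₂ \ D₁).card + (D₁ \ D).card := by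
      refine (Finset.card_le_card ?_).trans (Finset.card_union_le _ _)
      exact sdiff_triangle _ _ _
    have h3 : (D₂ \ D₁).card ≤ _ := card_sdiff_insert_cut_le hrx₁
    have h4 := hm.card_passed_le hps
    have h5 : (D₁ \ D).card ≤ _ :=
      Finset.card_le_card (layoutArcs_move_sdiff_subset (l := l) (r := r) (s := s) (P := P) (Q := Q))
    have h6 : lower s r ×ˢ upper s l ⊆ (lower s r ∪ P) ×ˢ (upper s l ∪ Q) :=
      Finset.product_subset_product Finset.subset_union_left Finset.subset_union_left
    rw [Finset.card_sdiff_of_subset h6, Finset.card_product, Finset.card_product, hPc, hQc] at h5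
    have h7 := Finset.card_le_card h6
    rw [Finset.card_product, Finset.card_product, hPc, hQc] at h7
    omega

theorem mem_available {D : Arcs n} {e : Fin n × Fin n} :
    e ∈ available D ↔ e.1 ≠ e.2 ∧ e ∉ D ∧ e.swap ∉ D := by
  simp [available]

/-- Neither end of an available arc is above the central cut, or neither is below it; in both cases
OBreaker has an answer. -/
theorem HasLayout.exists_answer {D : Arcs n} {s s' a c : ℕ} (h : HasLayout D s s' a c)
    {e : Fin n × Fin n} (he : e ∈ available D) :
    (∀ a' c', a + 1 ≤ a' → c ≤ c' → a' + c' ≤ n → (c' = c ∨ a' + c' < n) → (c < c' ∨ s' < c) →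
      ∃ D', HasLayout D' (s + 1) s' a' c' ∧ insert e D ⊆ D' ∧ (D' \ insert e D).Nonempty ∧
        (D' \ insert e D).card + a * c ≤ s + a' * c') ∨
    (∀ a' c', a ≤ a' → c + 1 ≤ c' → a' + c' ≤ n → (a' = a ∨ a' + c' < n) → (a < a' ∨ s < a) →
      ∃ D', HasLayout D' s (s' + 1) a' c' ∧ insert e D ⊆ D' ∧ (D' \ insert e D).Nonempty ∧
        (D' \ insert e D).card + a * c ≤ s' + a' * c') := by
  obtain ⟨hne, h1, h2⟩ := mem_available.1 he
  obtain ⟨x, y⟩ := e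
  obtain ⟨l, r, hl, rfl, rfl, rfl⟩ := h
  simp only [mem_layoutArcs, not_lt, Prod.swap_prod_mk] at h1 h2 hne
  by_cases hs : l x ≤ s ∧ l y ≤ s
  · exact Or.inl fun a' c' ha hc hn hn' hc' =>
      hl.exists_answer hne h1 h2 hs.1 hs.2 ha hc hn hn' hc'
  · refine Or.inr fun a' c' ha' hc' hn hn' hne' => ?_
    have hx := hl.le x
    have hy := hl.le y
    have hbx := hl.bound x
    have hby := hl.bound y
    obtain ⟨D', hD', hsub, hnon, hcard⟩ := hl.reverse.exists_answer (x := y) (y := x) hne.symm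
      (by omega) (by omega) (by omega) (by omega) (a' := c') (c' := a')
      (by rwa [hl.lower_reverse]) (by rwa [hl.upper_reverse]) (by omega)
      (by rw [hl.upper_reverse]; omega) (by rw [hl.upper_reverse]; omega)
    rw [hl.layoutArcs_reverse] at hsub hnon hcard
    rw [hl.lower_reverse, hl.upper_reverse] at hcard
    have hins : insert (y, x) (reverseArcs (layoutArcs l r)) =
        reverseArcs (insert (x, y) (layoutArcs l r)) := (reverseArcs_insert (x, y) _).symm
    have hrev : reverseArcs D' \ insert (x, y) (layoutArcs l r) =
        reverseArcs (D' \ insert (y, x) (reverseArcs (layoutArcs l r))) := by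
      rw [reverseArcs_sdiff, hins, reverseArcs_reverseArcs]
    refine ⟨reverseArcs D', hD'.reverse, ?_, ?_, ?_⟩
    · rw [hins, reverseArcs_subset_iff] at hsub
      exact hsub
    · rw [hrev, ← Finset.card_pos, card_reverseArcs]
      exact hnon.card_pos
    · rw [hrev, card_reverseArcs]
      nlinarith

/-- If no vertex is on the central cut, no vertex has to be moved across it, and the number of arcs
is bounded by the size of the side in which the arc `(x, y)` lies. -/
theorem IsLayout.exists_answer_of_cover {s s' : ℕ} {l r : Fin n → ℕ} (h : IsLayout s s' l r)
    (hcov : (lower s r).card + (upper s l).card = n)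
    {x y : Fin n} (hxy : x ≠ y) (hyx : l y ≤ r x) (hxy' : l x ≤ r y) (hlx : l x ≤ s) :
    ∃ D', HasLayout D' (s + 1) s' (lower s r).card (upper s l).card ∧
      insert (x, y) (layoutArcs l r) ⊆ D' ∧
      (D' \ layoutArcs l r).card + 1 ≤ (lower s r).card := by
  have hm := card_middle_add h
  have hcov' : ∀ v, r v ≤ s ∨ s + 1 ≤ l v := by
    intro v
    by_contra hv
    have : v ∈ middle l r s := by rw [mem_middle]; omega
    have := Finset.card_pos.2 ⟨v, this⟩
    omega
  have hrx : r x ≤ s := by have := hcov' x; omega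
  have hlrx := h.le x
  have hlry := h.le y
  obtain ⟨p, hlp, hlp', hpx, hpy⟩ : ∃ p, l x ≤ p ∧ l y ≤ p ∧ p ≤ r x ∧ p ≤ r y :=
    ⟨max (l x) (l y), by omega, by omega, by omega, by omega⟩
  have hps : p ≤ s := hpx.trans hrx
  refine ⟨layoutArcs (insertL l p y) (insertR r p x), ⟨_, _,
    h.insert_cut hxy hrx hlp hlp' hpx hpy, rfl, ?_, ?_⟩,
    layoutArcs_subset_insert_cut hlp' hpx, ?_⟩
  · rw [lower_insertR hrx hpx]
  · rw [upper_insertL hps hlp']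
  · have h1 := card_sdiff_insert_cut_le (l := l) (y := y) (p := p) hrx
    have h2 := h.card_passed_add_two_le hcov' hxy hps hlp hlp' hpx hpy
    omega

theorem HasLayout.exists_answer_of_cover {D : Arcs n} {s s' a c : ℕ} (h : HasLayout D s s' a c)
    (hcov : a + c = n) {e : Fin n × Fin n} (he : e ∈ available D) :
    ∃ D' s₁ s₁', HasLayout D' s₁ s₁' a c ∧ insert e D ⊆ D' ∧ (D' \ D).card + 1 ≤ max a c := by
  obtain ⟨hne, h1, h2⟩ := mem_available.1 he
  obtain ⟨x, y⟩ := e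
  obtain ⟨l, r, hl, rfl, rfl, rfl⟩ := h
  simp only [mem_layoutArcs, not_lt, Prod.swap_prod_mk] at h1 h2 hne
  by_cases hs : l x ≤ s ∧ l y ≤ s
  · obtain ⟨D', h3, h4, h5⟩ := hl.exists_answer_of_cover hcov hne h1 h2 hs.1
    exact ⟨D', _, _, h3, h4, h5.trans (le_max_left _ _)⟩
  · have hx := hl.le x
    have hy := hl.le y
    have hbx := hl.bound x
    have hby := hl.bound y
    obtain ⟨D', hD', hsub, hcard⟩ := hl.reverse.exists_answer_of_cover
      (by rw [hl.lower_reverse, hl.upper_reverse]; omega) (x := y) (y := x) hne.symm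
      (by omega) (by omega) (by omega)
    rw [hl.lower_reverse, hl.upper_reverse] at hD'
    rw [hl.layoutArcs_reverse] at hsub hcard
    rw [hl.lower_reverse] at hcard
    refine ⟨reverseArcs D', _, _, hD'.reverse, ?_, ?_⟩
    · rw [← reverseArcs_subset_iff, reverseArcs_insert]
      exact hsub
    · refine le_trans (Nat.succ_le_succ ?_) (hcard.trans (le_max_right _ _))
      rw [← card_reverseArcs (D' \ _), reverseArcs_sdiff, reverseArcs_reverseArcs]

end

section

variable {n b : ℕ}

/-! ### Positions without vertices on the central cut, and the second phase -/

/-- If all vertices are below or above the central cut and each of the two sides has at most `b`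
vertices, an arc inside one of the sides can be answered there. -/
theorem HasLayout.breakerWinsFrom_of_cover {a c : ℕ} (hcov : a + c = n) (ha : a ≤ b) (hc : c ≤ b) :
    ∀ (D : Arcs n) (s s' : ℕ), HasLayout D s s' a c → BreakerWinsFrom b D := by
  suffices H : ∀ (k : ℕ) (D : Arcs n) (s s' : ℕ), (Finset.univ \ D).card ≤ k →
      HasLayout D s s' a c → BreakerWinsFrom b D from fun D s s' h => H _ D s s' le_rfl h
  have hb : max a c ≤ b := max_le ha hc
  intro k
  induction k with
  | zero =>
    intro D s s' hk h
    refine .of_forall_arc h.not_hasDirectedCycle fun e he => ?_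
    have : e ∈ Finset.univ \ D :=
      Finset.mem_sdiff.2 ⟨Finset.mem_univ _, (mem_available.1 he).2.1⟩
    have := Finset.card_pos.2 ⟨e, this⟩
    omega
  | succ k ih =>
    intro D s s' hk h
    refine .of_forall_arc h.not_hasDirectedCycle fun e he => ?_
    have hmeas : ∀ {D' : Arcs n}, insert e D ⊆ D' → (Finset.univ \ D').card ≤ k := by
      intro D' hsub
      refine Nat.le_of_lt_succ (lt_of_lt_of_le (Finset.card_lt_card ?_) hk)
      refine Finset.ssubset_iff_subset_ne.2 ⟨Finset.sdiff_subset_sdiff le_rfl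
        ((Finset.subset_insert _ _).trans hsub), fun heq => ?_⟩
      have h1 : e ∈ Finset.univ \ D :=
        Finset.mem_sdiff.2 ⟨Finset.mem_univ _, (mem_available.1 he).2.1⟩
      rw [← heq] at h1
      exact (Finset.mem_sdiff.1 h1).2 (hsub (Finset.mem_insert_self _ _))
    obtain ⟨D', s₁, s₁', hD', hsub, hcard⟩ := h.exists_answer_of_cover hcov he
    by_cases hS : (D' \ insert e D).Nonempty
    · refine Or.inr ⟨D', ih _ _ _ (hmeas hsub) hD', hsub, hD'.isMove hsub hS ?_⟩
      have : (D' \ insert e D).card ≤ (D' \ D).card :=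
        Finset.card_le_card (Finset.sdiff_subset_sdiff le_rfl (Finset.subset_insert _ _))
      omega
    · -- The arc of OMaker needs no answer, and OBreaker answers a further arc of his own choice.
      have hDe : D' = insert e D :=
        (Finset.sdiff_eq_empty_iff_subset.1 (Finset.not_nonempty_iff_eq_empty.1 hS)).antisymm hsub
      subst hDe
      rcases Finset.eq_empty_or_nonempty (available (insert e D)) with h0 | ⟨e', he'⟩
      · exact Or.inl ⟨h0, hD'.not_hasDirectedCycle⟩
      · obtain ⟨D'', s₂, s₂', hD'', hsub', hcard'⟩ := hD'.exists_answer_of_cover hcov he'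
        have hsub'' := (Finset.subset_insert _ _).trans hsub'
        refine Or.inr ⟨D'', ih _ _ _ (hmeas hsub'') hD'', hsub'', hD''.isMove hsub'' ⟨e', ?_⟩ ?_⟩
        · exact Finset.mem_sdiff.2 ⟨hsub' (Finset.mem_insert_self _ _), (mem_available.1 he').2.1⟩
        · omega

/-- The condition that OBreaker brings about in the first phase: the numbers `s + i` and `s' + j` of
vertices below and above the central cut exceed those of the lower and upper cuts by at least
`n - b`. OBreaker then adds one vertex per round. -/
theorem HasLayout.breakerWinsFrom_of_le {i j : ℕ} (hi : n ≤ b + i) (hj : n ≤ b + j) (hi1 : 1 ≤ i)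
    (hj1 : 1 ≤ j) :
    ∀ (D : Arcs n) (s s' : ℕ), HasLayout D s s' (i + s) (j + s') → BreakerWinsFrom b D := by
  suffices H : ∀ (k : ℕ) (D : Arcs n) (s s' : ℕ), n ≤ (i + s) + (j + s') + k →
      HasLayout D s s' (i + s) (j + s') → BreakerWinsFrom b D from
    fun D s s' h => H n D s s' (by omega) h
  intro k
  induction k with
  | zero =>
    intro D s s' hk h
    have := h.add_le
    exact h.breakerWinsFrom_of_cover (by omega) (by omega) (by omega)
  | succ k ih =>
    intro D s s' hk h
    have hn := h.add_le
    rcases hn.eq_or_lt with hcov | hlt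
    · exact h.breakerWinsFrom_of_cover (by omega) (by omega) (by omega)
    refine .of_forall_arc h.not_hasDirectedCycle fun e he => Or.inr ?_
    rcases h.exists_answer he with H | H
    · obtain ⟨D', hD', hsub, hne, hcard⟩ := H (i + (s + 1)) (j + s') (by omega) le_rfl (by omega)
        (.inl rfl) (.inr (by omega))
      refine ⟨D', ih _ _ _ (by omega) hD', hsub, hD'.isMove hsub hne ?_⟩
      have : (i + (s + 1)) * (j + s') = (i + s) * (j + s') + (j + s') := by ring
      omega
    · obtain ⟨D', hD', hsub, hne, hcard⟩ := H (i + s) (j + (s' + 1)) le_rfl (by omega) (by omega)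
        (.inl rfl) (.inr (by omega))
      refine ⟨D', ih _ _ _ (by omega) hD', hsub, hD'.isMove hsub hne ?_⟩
      have : (i + s) * (j + (s' + 1)) = (i + s) * (j + s') + (i + s) := by ring
      omega

/-- All vertices may be placed below the central cut at the start. -/
theorem breakerWinsFrom_empty_of_le (h : n ≤ b) : BreakerWinsFrom b (∅ : Arcs n) := by
  refine HasLayout.breakerWinsFrom_of_cover (a := n) (c := 0) (by omega) h (by omega) ∅ 0 0
    ⟨fun _ => 0, fun _ => 0, ⟨?_, ?_, ?_, ?_⟩, ?_, ?_, ?_⟩ <;>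
  simp [lower, upper, layoutArcs]

/-! ### The first phase -/

/-- OBreaker wins from all positions with `s` lower and `s'` upper cuts in which the numbers of
vertices below and above the central cut exceed those of the lower and upper cuts by `i` and `j`. -/
def BreakerWinsAt (n b i j s s' : ℕ) : Prop :=
  ∀ D : Arcs n, HasLayout D s s' (i + s) (j + s') → BreakerWinsFrom b D

/-- One round in which the excesses grow by `α` and `β`. The conditions `hcl` and `hcr` say that
OBreaker's bias suffices if the new cut is a lower or an upper one, respectively; in the first case,
for example, `i + s + 1 + α` and `j + s' + β` vertices are to be below and above the central cut. -/
theorem BreakerWinsAt.of_round {i j s s' α β : ℕ}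
    (hn : i + s + α + (j + s' + β) + 1 < n)
    (hl : 0 < β ∨ 0 < j) (hr : 0 < α ∨ 0 < i)
    (hcl : s + (1 + α) * (j + s') + β * (i + s + 1 + α) ≤ b)
    (hcr : s' + (1 + β) * (i + s) + α * (j + s' + 1 + β) ≤ b)
    (h1 : BreakerWinsAt n b (i + α) (j + β) (s + 1) s')
    (h2 : BreakerWinsAt n b (i + α) (j + β) s (s' + 1)) : BreakerWinsAt n b i j s s' := by
  intro D h
  refine .of_forall_arc h.not_hasDirectedCycle fun e he => Or.inr ?_
  rcases h.exists_answer he with H | H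
  · obtain ⟨D', hD', hsub, hne, hcard⟩ := H (i + α + (s + 1)) (j + β + s') (by omega) (by omega)
      (by omega) (.inr (by omega)) (by omega)
    refine ⟨D', h1 D' hD', hsub, hD'.isMove hsub hne ?_⟩
    have : (i + α + (s + 1)) * (j + β + s') =
      (i + s) * (j + s') + ((1 + α) * (j + s') + β * (i + s + 1 + α)) := by ring
    omega
  · obtain ⟨D', hD', hsub, hne, hcard⟩ := H (i + α + s) (j + β + (s' + 1)) (by omega) (by omega)
      (by omega) (.inr (by omega)) (by omega)
    refine ⟨D', h2 D' hD', hsub, hD'.isMove hsub hne ?_⟩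
    have : (i + α + s) * (j + β + (s' + 1)) =
      (i + s) * (j + s') + ((1 + β) * (i + s) + α * (j + s' + 1 + β)) := by ring
    omega

/-- `N` rounds in each of which both excesses grow by `e`. The cost depends on `s` and `s'` only
through their sum, the number of rounds played. -/
theorem BreakerWinsAt.of_pair_rounds {e : ℕ} (he : 1 ≤ e) :
    ∀ (N i t : ℕ), 2 * (i + e * N) + (t + N) < n →
      (2 * e + 1) * (i + e * N) + (e + 1) * (t + N) ≤ b →
      (∀ s s', s + s' = t + N → BreakerWinsAt n b (i + e * N) (i + e * N) s s') →
      ∀ s s', s + s' = t → BreakerWinsAt n b i i s s' := by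
  intro N
  induction N with
  | zero => intro i t _ _ h s s' hs; simpa using h s s' (by omega)
  | succ N ih =>
    intro i t hn hb h s s' hs
    have e1 : i + e * (N + 1) = i + e + e * N := by ring
    have e2 : t + (N + 1) = t + 1 + N := by ring
    rw [e1, e2] at hn hb h
    have key := ih (i + e) (t + 1) hn hb h
    clear e1
    have h2 : (2 * e + 1) * (i + e) + (e + 1) * (t + 1) ≤ b :=
      le_trans (add_le_add (Nat.mul_le_mul_left _ (Nat.le_add_right _ _))
        (Nat.mul_le_mul_left _ (Nat.le_add_right _ _))) hb
    subst hs
    refine .of_round (α := e) (β := e) (by omega) (.inl he) (.inl he) ?_ ?_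
      (key _ _ (by omega)) (key _ _ (by omega)) <;> nlinarith

/-- `N` rounds in each of which the excess above the central cut grows by one. -/
theorem BreakerWinsAt.of_upper_rounds {i : ℕ} (hi : 1 ≤ i) :
    ∀ (N j s s' : ℕ), i + j + s + s' + 2 * N < n →
      2 * s + s' + 3 * N + i + j ≤ b → 2 * s + s' + 2 * N + 2 * i ≤ b →
      (∀ k k', k + k' = N → BreakerWinsAt n b i (j + N) (s + k) (s' + k')) →
      BreakerWinsAt n b i j s s' := by
  intro N
  induction N with
  | zero => intro j s s' _ _ _ h; simpa using h 0 0 rfl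
  | succ N ih =>
    intro j s s' hn hb hb' h
    refine .of_round (α := 0) (β := 1) (by omega) (.inl one_pos) (.inr hi) (by omega) (by omega)
      (ih _ _ _ (by omega) (by omega) (by omega) fun k k' hk => ?_)
      (ih _ _ _ (by omega) (by omega) (by omega) fun k k' hk => ?_)
    · have := h (k + 1) k' (by omega)
      rwa [show j + (N + 1) = j + 1 + N by ring, show s + (k + 1) = s + 1 + k by ring] at this
    · have := h k (k' + 1) (by omega)
      rwa [show j + (N + 1) = j + 1 + N by ring, show s' + (k' + 1) = s' + 1 + k' by ring] at this

/-- `N` rounds in each of which the excess below the central cut grows by one. -/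
theorem BreakerWinsAt.of_lower_rounds {j : ℕ} (hj : 1 ≤ j) :
    ∀ (N i s s' : ℕ), i + j + s + s' + 2 * N < n →
      s + 2 * s' + 3 * N + i + j ≤ b → s + 2 * s' + 2 * N + 2 * j ≤ b →
      (∀ k k', k + k' = N → BreakerWinsAt n b (i + N) j (s + k) (s' + k')) →
      BreakerWinsAt n b i j s s' := by
  intro N
  induction N with
  | zero => intro i s s' _ _ _ h; simpa using h 0 0 rfl
  | succ N ih =>
    intro i s s' hn hb hb' h
    refine .of_round (α := 1) (β := 0) (by omega) (.inr hj) (.inl one_pos) (by omega) (by omega)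
      (ih _ _ _ (by omega) (by omega) (by omega) fun k k' hk => ?_)
      (ih _ _ _ (by omega) (by omega) (by omega) fun k k' hk => ?_)
    · have := h (k + 1) k' (by omega)
      rwa [show i + (N + 1) = i + 1 + N by ring, show s + (k + 1) = s + 1 + k by ring] at this
    · have := h k (k' + 1) (by omega)
      rwa [show i + (N + 1) = i + 1 + N by ring, show s' + (k' + 1) = s' + 1 + k' by ring] at this

/-- `N` rounds for either excess, beginning with the side that has more cuts: there every vertex is
the dearer, and the dearer the later it is added. -/
theorem BreakerWinsAt.of_single_rounds {i t N s s' : ℕ} (hi : 1 ≤ i) (hs : s + s' = t)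
    (hn : 2 * i + t + 4 * N < n) (hb : 4 * i + 3 * t + 12 * N ≤ 2 * b)
    (hb' : 2 * i + 2 * t + 3 * N ≤ b)
    (h : ∀ s s', BreakerWinsAt n b (i + N) (i + N) s s') : BreakerWinsAt n b i i s s' := by
  rcases le_total s' s with hle | hle
  · exact .of_upper_rounds hi N _ _ _ (by omega) (by omega) (by omega) fun k k' hk =>
      .of_lower_rounds (by omega) N _ _ _ (by omega) (by omega) (by omega) fun _ _ _ => h _ _
  · exact .of_lower_rounds hi N _ _ _ (by omega) (by omega) (by omega) fun k k' hk =>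
      .of_upper_rounds (by omega) N _ _ _ (by omega) (by omega) (by omega) fun _ _ _ => h _ _

/-- The numbers of rounds with increments `4`, `3`, `2`, `1` of both excesses and with increment `1`
of one excess are chosen as large as the bias allows, up to rounding. -/
theorem breakerWinsFrom_empty (hnb : b < n) (h : 10000 * n + 110000 ≤ 12967 * b) :
    BreakerWinsFrom b (∅ : Arcs n) := by
  obtain ⟨N₄, h₄⟩ : ∃ N, N = 243 * b / 10000 := ⟨_, rfl⟩
  obtain ⟨N₃, h₃⟩ : ∃ N, N = 88 * b / 10000 := ⟨_, rfl⟩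
  obtain ⟨N₂, h₂⟩ : ∃ N, N = 217 * b / 10000 := ⟨_, rfl⟩
  obtain ⟨N₁, h₁⟩ : ∃ N, N = 778 * b / 10000 := ⟨_, rfl⟩
  obtain ⟨N, h₀⟩ : ∃ N, N = 519 * b / 10000 := ⟨_, rfl⟩
  have start : BreakerWinsAt n b 0 0 0 0 := by
    refine .of_pair_rounds (e := 4) (by norm_num) N₄ 0 0 (by omega) (by omega) ?_ 0 0 rfl
    refine .of_pair_rounds (e := 3) (by norm_num) N₃ _ _ (by omega) (by omega) ?_
    refine .of_pair_rounds (e := 2) (by norm_num) N₂ _ _ (by omega) (by omega) ?_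
    refine .of_pair_rounds (e := 1) (by norm_num) N₁ _ _ (by omega) (by omega) ?_
    intro s s' hs
    exact .of_single_rounds (N := N) (by omega) hs (by omega) (by omega) (by omega) fun s s' D hD =>
      hD.breakerWinsFrom_of_le (by omega) (by omega) (by omega) (by omega)
  refine start ∅ ⟨fun _ => 0, fun _ => 1, ⟨?_, ?_, ?_, ?_⟩, ?_, ?_, ?_⟩ <;>
  simp [lower, upper, layoutArcs]

end

/-! ### Bounds for the constant `C_B` -/

theorem g_one (B : ℕ) : g B 1 = -1 / 2 + √((B : ℝ) - 1 / 4) := by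
  simp only [g, G]
  norm_num

theorem le_sqrt_div {q m X : ℝ} (hm : 0 ≤ m) (hmX : m ≤ X)
    (hq : q ^ 2 * (m ^ 2 + 1) ≤ m ^ 2) : q ≤ √(X ^ 2 / (X ^ 2 + 1)) := by
  apply Real.le_sqrt_of_sq_le
  have h1 : m ^ 2 ≤ X ^ 2 := by gcongr
  rw [le_div_iff₀ (by positivity)]
  by_cases h : q ^ 2 ≤ 1
  · nlinarith
  · nlinarith [sq_nonneg m]

theorem sqrt_div_le_one (X : ℝ) : √(X ^ 2 / (X ^ 2 + 1)) ≤ 1 := by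
  refine Real.sqrt_le_iff.2 ⟨zero_le_one, ?_⟩
  rw [div_le_iff₀ (by positivity)]
  linarith

/-- No property of `gInv` is needed for this: a real power with exponent `-1/2` is non-negative,
for a negative base because it is then `0`. -/
theorem half_le_phi (B a : ℕ) : 1 / 2 ≤ phi B a := by
  have key : ∀ x : ℝ, 0 ≤ x ^ (-(1 / 2) : ℝ) := by
    intro x
    rcases le_or_gt 0 x with hx | hx
    · exact Real.rpow_nonneg hx _
    · rw [Real.rpow_def_of_neg hx,
        show (-(1 / 2) : ℝ) * Real.pi = -(Real.pi / 2) by ring, Real.cos_neg, Real.cos_pi_div_two,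
        mul_zero]
  unfold phi
  linarith [key (16 * (B : ℝ) / gInv B ((a : ℝ) + 1 / 2) - 4)]

/-- The `a`-th term of the sum in `C B`. -/
noncomputable def summand (B a : ℕ) : ℝ :=
  2 - √((2 * ((a : ℝ) + phi B a) + 1) ^ 2 / ((2 * ((a : ℝ) + phi B a) + 1) ^ 2 + 1))
    - √((2 * (a : ℝ) + 3) ^ 2 / ((2 * (a : ℝ) + 3) ^ 2 + 1))

theorem C_eq (B : ℕ) : C B = 1 - (1 + (⌊g B 1⌋₊ : ℝ)) / (2 * (B : ℝ)) +
    ∑ a ∈ Finset.range ⌊g B 1⌋₊, summand B a := rfl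

theorem summand_nonneg (B a : ℕ) : 0 ≤ summand B a := by
  have h1 := sqrt_div_le_one (2 * ((a : ℝ) + phi B a) + 1)
  have h2 := sqrt_div_le_one (2 * (a : ℝ) + 3)
  unfold summand
  linarith

theorem summand_le {q q' : ℝ} (B a : ℕ)
    (hq : q ^ 2 * ((2 * (a : ℝ) + 2) ^ 2 + 1) ≤ (2 * (a : ℝ) + 2) ^ 2)
    (hq' : q' ^ 2 * ((2 * (a : ℝ) + 3) ^ 2 + 1) ≤ (2 * (a : ℝ) + 3) ^ 2) :
    summand B a ≤ 2 - q - q' := by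
  have h1 : q ≤ √((2 * ((a : ℝ) + phi B a) + 1) ^ 2 / ((2 * ((a : ℝ) + phi B a) + 1) ^ 2 + 1)) :=
    le_sqrt_div (by positivity) (by linarith [half_le_phi B a]) hq
  have h2 := le_sqrt_div (by positivity) le_rfl hq'
  unfold summand
  linarith

theorem summand_zero_le (B : ℕ) : summand B 0 ≤ 0.15690 :=
  (summand_le (q := 0.89442) (q' := 0.94868) B 0 (by norm_num) (by norm_num)).trans (by norm_num)

theorem sum_range_four_le (B : ℕ) : ∑ a ∈ Finset.range 4, summand B a ≤ 0.24371 := by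
  have h0 := summand_zero_le B
  have h1 := summand_le (q := 0.97014) (q' := 0.98058) B 1 (by norm_num) (by norm_num)
  have h2 := summand_le (q := 0.98639) (q' := 0.98994) B 2 (by norm_num) (by norm_num)
  have h3 := summand_le (q := 0.99227) (q' := 0.99388) B 3 (by norm_num) (by norm_num)
  simp only [Finset.sum_range_succ, Finset.sum_range_zero]
  norm_num at h0 h1 h2 h3 ⊢
  linarith

/-- The tail of the sum telescopes, since `1 - m / √(m² + 1) ≤ 1 / (2 m² - 1 / 2)`. -/
theorem summand_le_telescope (B a : ℕ) :
    summand B a ≤ 1 / (4 * (a : ℝ) + 3) - 1 / (4 * ((a + 1 : ℕ) : ℝ) + 3) := by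
  have key : ∀ m : ℝ, 2 ≤ m →
      (1 - (1 / (2 * m - 1) - 1 / (2 * m + 1))) ^ 2 * (m ^ 2 + 1) ≤ m ^ 2 := by
    intro m hm
    have h1 : 0 < 2 * m - 1 := by linarith
    have h2 : 0 < 2 * m + 1 := by linarith
    have h3 : 1 - (1 / (2 * m - 1) - 1 / (2 * m + 1)) = (4 * m ^ 2 - 3) / (4 * m ^ 2 - 1) := by
      have : 4 * m ^ 2 - 1 = (2 * m - 1) * (2 * m + 1) := by ring
      rw [this]
      field_simp
      ring
    have h4 : 0 < 4 * m ^ 2 - 1 := by nlinarith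
    rw [h3, div_pow, div_mul_eq_mul_div, div_le_iff₀ (by positivity)]
    nlinarith
  have ha : (0 : ℝ) ≤ a := Nat.cast_nonneg a
  refine (summand_le B a (key _ (by linarith)) (key _ (by linarith))).trans (le_of_eq ?_)
  push_cast
  rw [show 2 * (2 * (a : ℝ) + 2) - 1 = 4 * a + 3 by ring,
    show 2 * (2 * (a : ℝ) + 2) + 1 = 4 * a + 5 by ring,
    show 2 * (2 * (a : ℝ) + 3) - 1 = 4 * a + 5 by ring,
    show 2 * (2 * (a : ℝ) + 3) + 1 = 4 * (a + 1) + 3 by ring]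
  ring

theorem sum_summand_le (B k : ℕ) : ∑ a ∈ Finset.range k, summand B a ≤ 0.2964 := by
  have h4 := sum_range_four_le B
  rcases le_total k 4 with hk | hk
  · have : ∑ a ∈ Finset.range k, summand B a ≤ ∑ a ∈ Finset.range 4, summand B a :=
      Finset.sum_le_sum_of_subset_of_nonneg (Finset.range_mono hk) fun a _ _ => summand_nonneg B a
    norm_num at h4 ⊢
    linarith
  · have h : ∑ a ∈ Finset.range k, summand B a ≤
        0.24371 + (1 / (4 * ((4 : ℕ) : ℝ) + 3) - 1 / (4 * (k : ℝ) + 3)) := by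
      induction k, hk using Nat.le_induction with
      | base => simpa using h4
      | succ k hk ih =>
        rw [Finset.sum_range_succ]
        linarith [summand_le_telescope B k]
    have h0 : 0 ≤ (4 * (k : ℝ) + 3)⁻¹ := by positivity
    norm_num at h ⊢
    linarith

theorem floor_g_one_le {B : ℕ} (hB : 1 ≤ B) : (⌊g B 1⌋₊ : ℝ) ≤ g B 1 := by
  have hB' : (1 : ℝ) ≤ B := by exact_mod_cast hB
  refine Nat.floor_le ?_
  rw [g_one]
  have : 1 / 2 ≤ √((B : ℝ) - 1 / 4) := Real.le_sqrt_of_sq_le (by norm_num; linarith)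
  linarith

theorem C_pos {B : ℕ} (hB : 1 ≤ B) : 0 < C B := by
  have hB' : (1 : ℝ) ≤ B := by exact_mod_cast hB
  have h1 := floor_g_one_le hB
  have h2 : √((B : ℝ) - 1 / 4) ≤ B := Real.sqrt_le_iff.2 ⟨by linarith, by nlinarith⟩
  rw [g_one] at h1
  have h3 : (1 + (⌊g B 1⌋₊ : ℝ)) / (2 * B) < 1 := by
    rw [g_one, div_lt_one (by linarith)]
    linarith
  have h4 := Finset.sum_nonneg fun a (_ : a ∈ Finset.range ⌊g B 1⌋₊) => summand_nonneg B a
  rw [C_eq]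
  linarith

theorem C_le (B : ℕ) : C B ≤ 1.2964 := by
  have h1 := sum_summand_le B ⌊g B 1⌋₊
  have h2 : 0 ≤ (1 + (⌊g B 1⌋₊ : ℝ)) / (2 * (B : ℝ)) := by positivity
  rw [C_eq]
  norm_num at h1 ⊢
  linarith

theorem C_le_one {B : ℕ} (hB : 1 ≤ B) (hB6 : B ≤ 6) : C B ≤ 1 := by
  have hB' : (1 : ℝ) ≤ B := by exact_mod_cast hB
  have hB6' : (B : ℝ) ≤ 6 := by exact_mod_cast hB6
  have h1 := floor_g_one_le hB
  have h2 : √((B : ℝ) - 1 / 4) < 5 / 2 := by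
    rw [Real.sqrt_lt' (by norm_num)]
    norm_num
    linarith
  have h3 : ⌊g B 1⌋₊ < 2 := by
    have h4 : (⌊g B 1⌋₊ : ℝ) < 2 := by rw [g_one] at h1 ⊢; linarith
    exact_mod_cast h4
  rw [C_eq]
  interval_cases ⌊g B 1⌋₊
  · have : 0 ≤ 1 / (2 * (B : ℝ)) := by positivity
    simp only [CharP.cast_eq_zero, Finset.range_zero, Finset.sum_empty, add_zero]
    linarith
  · have h4 := summand_zero_le B
    have h5 : 1 / 6 ≤ (1 + ((1 : ℕ) : ℝ)) / (2 * (B : ℝ)) := by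
      rw [le_div_iff₀ (by linarith)]
      push_cast
      linarith
    simp only [Finset.sum_range_one]
    norm_num at h4 h5 ⊢
    linarith

/-! ### The threshold bias -/

theorem bddAbove_oMakerWins (n : ℕ) :
    BddAbove {b : ℕ | 1 ≤ b ∧ OMakerWins (HasDirectedCycle (n := n)) b} :=
  ⟨n, fun b hb => by
    by_contra! h
    exact (breakerWinsFrom_empty_of_le h.le).not_oMakerWins hb.2⟩

theorem oMakerWins_iff_le_thresholdBias {n b : ℕ} (hb : 1 ≤ b) :
    OMakerWins (HasDirectedCycle (n := n)) b ↔ b ≤ thresholdBias (HasDirectedCycle (n := n)) := by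
  constructor
  · exact fun h => le_csSup (bddAbove_oMakerWins n) ⟨hb, h⟩
  · intro h
    have hne : {b : ℕ | 1 ≤ b ∧ OMakerWins (HasDirectedCycle (n := n)) b}.Nonempty := by
      by_contra hempty
      rw [Set.not_nonempty_iff_eq_empty] at hempty
      rw [thresholdBias, hempty, csSup_empty, bot_eq_zero] at h
      omega
    exact (Nat.sSup_mem hne (bddAbove_oMakerWins n)).2.anti h

/-- If `C B ≤ 1`, which holds for `B ≤ 6`, the hypothesis gives `n ≤ b`. Otherwise it gives
`n ≤ 1.2967 b - 11`: the summand `C B * B` makes up for the rounding loss `11`. -/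
theorem breakerWinsFrom_empty_of_lt {B : ℕ} (hB : 1 ≤ B) {n b : ℕ}
    (h : (n : ℝ) / C B + C B * B < b) : BreakerWinsFrom b (∅ : Arcs n) := by
  rcases le_or_gt n b with hnb | hnb
  · exact breakerWinsFrom_empty_of_le hnb
  have hC := C_pos hB
  have hC' := C_le B
  have hnb' : (b : ℝ) < n := by exact_mod_cast hnb
  have hB' : (1 : ℝ) ≤ B := by exact_mod_cast hB
  have h1 : (n : ℝ) + C B ^ 2 * B < C B * b := by
    have : (n : ℝ) + C B ^ 2 * B = C B * (n / C B + C B * B) := by field_simp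
    rw [this]
    gcongr
  have hb0 : (0 : ℝ) ≤ b := Nat.cast_nonneg b
  have hB2 : 0 ≤ C B ^ 2 * B := by positivity
  obtain ⟨c, hc⟩ : ∃ c, C B = 1 + c := ⟨C B - 1, by ring⟩
  have hc0 : 0 < c := by
    by_contra! hcon
    rw [hc] at h1 hB2
    nlinarith
  have hB7 : (7 : ℝ) ≤ B := by
    by_contra! hcon
    have : B < 7 := by exact_mod_cast hcon
    linarith [C_le_one hB (by omega)]
  rw [hc] at h1 hC' hB2
  norm_num at hC'
  have hcu : c ≤ 0.2964 := by norm_num; linarith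
  norm_num at hcu
  have h2 : (1 + c) ^ 2 * B < c * b := by nlinarith
  have h3 : 7 * (1 + 2 * c) ≤ (1 + c) ^ 2 * B := by nlinarith [sq_nonneg c]
  have h4 : 0 ≤ c * ((0.2967 - c) * b + (1 + c) ^ 2 * B - 11) := by
    have h5 : 0 ≤ 0.2967 - c := by norm_num; linarith
    have h6 := mul_le_mul_of_nonneg_left h2.le h5
    nlinarith
  have h5 := nonneg_of_mul_nonneg_right h4 hc0
  refine breakerWinsFrom_empty hnb ?_
  have h6 : (10000 * n + 110000 : ℝ) ≤ 12967 * b := by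
    norm_num at h5
    nlinarith
  exact_mod_cast h6

end OrientationGame

theorem mainTheorem2 (B : ℕ) (hB : 3 ≤ B) (n : ℕ) :
    (∀ b : ℕ, 1 ≤ b →
      (OrientationGame.OMakerWins (OrientationGame.HasDirectedCycle (n := n)) b ↔
        b ≤ OrientationGame.thresholdBias (OrientationGame.HasDirectedCycle (n := n)))) ∧
    (OrientationGame.thresholdBias (OrientationGame.HasDirectedCycle (n := n)) : ℝ) ≤
      (n : ℝ) / OrientationGame.C B + OrientationGame.C B * (B : ℝ) := by
  refine ⟨fun b hb => OrientationGame.oMakerWins_iff_le_thresholdBias hb, ?_⟩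
  have hC := OrientationGame.C_pos (B := B) (by omega)
  rcases Nat.eq_zero_or_pos
    (OrientationGame.thresholdBias (OrientationGame.HasDirectedCycle (n := n))) with h0 | h0
  · rw [h0, Nat.cast_zero]
    positivity
  · by_contra! h
    exact (OrientationGame.breakerWinsFrom_empty_of_lt (by omega) h).not_oMakerWins
      ((OrientationGame.oMakerWins_iff_le_thresholdBias h0).2 le_rfl)
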